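/- Let $k\ge 1$, let $\mathcal X=[a_1,b_1]\times\cdots\times[a_k,b_k]\subset\mathbb R^k$ with $a_j<b_j$ for all $j$, and let $\underline f\le\overline f$ be real constants. Write $\ell^\infty(\mathcal X)$ for the bounded measurable functions $f:\mathcal X\to\mathbb R$, and let - $\ell^\infty_S$ be the lower semicontinuous functions in $\ell^\infty(\mathcal X)$; - $\ell^\infty_C$ and $\ell^\infty_Q$ be the convex and the quasi-convex functions in $\ell^\infty_S$, respectively (quasi-convex: $f(\alpha x+(1-\alpha)x')\le\max\{f(x),f(x')\}$ for $\alpha\in[0,1]$); - $\ell^\infty_M$ be the functions in $\ell^\infty(\mathcal X)$ that are nondecreasing for the coordinatewise order; - $\ell^\infty_R$ be the functions in $\ell^\infty(\mathcal X)$ with values in $[\underline f,\overline f]$; - $\ell^\infty_{CMR}=\ell^\infty_C\cap\ell^\infty_M\cap\ell^\infty_R$ and $\ell^\infty_{QMR}=\ell^\infty_Q\cap\ell^\infty_M\cap\ell^\infty_R$. Define the following operators. - $\mathbf Rf(x)=\min\{\max\{\underline f,f(x)\},\overline f\}$. - $\mathbf Mf=\frac1{|\Pi|}\sum_{\pi\in\Pi}\mathbf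 M_{\pi_1}\circ\cdots\circ\mathbf M_{\pi_k}f$, where $\Pi$ is a fixed non-empty set of permutations of $\{1,\dots,k\}$ and $\mathbf M_j$ is the increasing rearrangement in the $j$-th coordinate: with $S_{j,x}(y)=\{t\in[a_j,b_j]: f(x_1,\dots,x_{j-1},t,x_{j+1},\dots,x_k)\le y\}$, $$\mathbf M_jf(x)=\inf\bigl\{y\in\mathbb R: S_{j,x}(y)\neq\emptyset,\ |S_{j,x}(y)|\ge x_j-a_j\bigr\},$$ where $|\cdot|$ is Lebesgue measure. (The condition $S_{j,x}(y)\ne\emptyset$ only matters when $x_j=a_j$; there $\mathbf M_jf(x)$ is the infimum of $f$ along the segment through $x$ in direction $j$.) - $\mathbf Cf(x)=\sup_{\xi\in f^*(\mathcal X)}\{\xi'x-f^*(\xi)\}$, where $f^*(\xi)=\sup_{x\in\mathcal X}\{\xi'x-f(x)\}$ and $f^*(\mathcal X)=\{\xi\in\mathbb R^k:f^*(\xi)<\infty\}$. - $\mathbf Qf(x)=\min\{y\in\mathbb R: x\in\mathrm{conv}\{z\in\mathcal X:f(z)\le y\}\}$. - $\mathbf{MR}=\mathbf M\circ\mathbf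 R$, $\mathbf{CMR}=\mathbf C\circ\mathbf M\circ\mathbf R$ and $\mathbf{QMR}=\mathbf Q\circ\mathbf M\circ\mathbf R$. For $\ell_1\subset\ell_0\subset\ell^\infty(\mathcal X)$, an operator $\mathbf O$ on $\ell_0$ is called *$\ell_1$-enforcing with respect to $\ell_0$* if $\mathbf Of\in\ell_1$ for all $f\in\ell_0$, $\mathbf Of=f$ for all $f\in\ell_1$, and $\mathbf Of\le\mathbf Og$ whenever $f,g\in\ell_0$ and $f\le g$ (pointwise on $\mathcal X$). It is a *$d_\infty$-distance contraction* if $\sup_{\mathcal X}|\mathbf Of-\mathbf Og|\le\sup_{\mathcal X}|f-g|$ for all $f,g\in\ell_0$. **Corollary (Composition with Range and Monotonicity Operators).** The operators $\mathbf{CMR}$ and $\mathbf{QMR}$ are well defined on $\ell^\infty_S$ (for $f\in\ell^\infty_S$ one has $\mathbf{MR}f\in\ell^\infty_S$, and the minimum defining $\mathbf Q(\mathbf{MR}f)(x)$ exists for every $x\in\mathcal X$), and (i) $\mathbf{CMR}$ is $\ell^\infty_{CMR}$-enforcing with respect to $\ell^\infty_S$ and a $d_\infty$-distance contraction; (ii)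 $\mathbf{QMR}$ is $\ell^\infty_{QMR}$-enforcing with respect to $\ell^\infty_S$ and a $d_\infty$-distance contraction. -/

import Mathlib

namespace ShapeEnforcing

open Set MeasureTheory

noncomputable section

/-! Function classes on a set `X ⊆ ℝᵏ`. Functions live on the subtype `X`, so that equality and
order of functions are equality and order at every point of `X` and nowhere else. -/

/-- Bounded measurable real functions on `X`. -/
def ellInf {k : ℕ} (X : Set (Fin k → ℝ)) : Set (X → ℝ) :=
  {f | Measurable f ∧ ∃ K : ℝ, ∀ x, |f x| ≤ K}

/-- Bounded lower semicontinuous functions. -/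
def ellS {k : ℕ} (X : Set (Fin k → ℝ)) : Set (X → ℝ) :=
  {f | f ∈ ellInf X ∧ LowerSemicontinuous f}

/-- Bounded functions with values between `lo` and `hi`. -/
def ellR {k : ℕ} (X : Set (Fin k → ℝ)) (lo hi : ℝ) : Set (X → ℝ) :=
  {f | f ∈ ellInf X ∧ ∀ x, lo ≤ f x ∧ f x ≤ hi}

/-- Bounded lower semicontinuous convex functions. -/
def ellC {k : ℕ} (X : Set (Fin k → ℝ)) : Set (X → ℝ) :=
  {f | f ∈ ellS X ∧ ∀ (x x' z : X) (α : ℝ), 0 ≤ α → α ≤ 1 →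
    (z : Fin k → ℝ) = α • (x : Fin k → ℝ) + (1 - α) • (x' : Fin k → ℝ) →
      f z ≤ α * f x + (1 - α) * f x'}

/-- Bounded lower semicontinuous quasi-convex functions. -/
def ellQ {k : ℕ} (X : Set (Fin k → ℝ)) : Set (X → ℝ) :=
  {f | f ∈ ellS X ∧ ∀ (x x' z : X) (α : ℝ), 0 ≤ α → α ≤ 1 →
    (z : Fin k → ℝ) = α • (x : Fin k → ℝ) + (1 - α) • (x' : Fin k → ℝ) →
      f z ≤ max (f x) (f x')}

/-- Bounded measurable functions that are nondecreasing for the coordinatewise order. -/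
def ellM {k : ℕ} (X : Set (Fin k → ℝ)) : Set (X → ℝ) :=
  {f | f ∈ ellInf X ∧ Monotone f}

def ellCMR {k : ℕ} (X : Set (Fin k → ℝ)) (lo hi : ℝ) : Set (X → ℝ) :=
  (ellC X ∩ ellM X) ∩ ellR X lo hi

def ellQMR {k : ℕ} (X : Set (Fin k → ℝ)) (lo hi : ℝ) : Set (X → ℝ) :=
  (ellQ X ∩ ellM X) ∩ ellR X lo hi

/-! Properties of operators. -/

/-- The operator `O` is `F₁`-enforcing with respect to `F₀`. -/
structure IsEnforcing {α : Type*} (F₁ F₀ : Set (α → ℝ)) (O : (α → ℝ) → (α → ℝ)) : Prop where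
  subset : F₁ ⊆ F₀
  reshaping : ∀ f ∈ F₀, O f ∈ F₁
  invariance : ∀ f ∈ F₁, O f = f
  order_preserving : ∀ f ∈ F₀, ∀ g ∈ F₀, f ≤ g → O f ≤ O g

/-- The operator `O` on `F₀` is a `ρ`-distance contraction. -/
def IsDistContraction {α : Type*} (ρ : (α → ℝ) → (α → ℝ) → ℝ) (F₀ : Set (α → ℝ))
    (O : (α → ℝ) → (α → ℝ)) : Prop :=
  ∀ f ∈ F₀, ∀ g ∈ F₀, ρ (O f) (O g) ≤ ρ f g

/-- The distance induced by the sup-norm (of bounded functions). -/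
def dInf {α : Type*} (f g : α → ℝ) : ℝ := ⨆ x, |f x - g x|

/-! The range operator. -/

def opR {α : Type*} (lo hi : ℝ) (f : α → ℝ) : α → ℝ := fun x => min (max lo (f x)) hi

/-! The double Legendre-Fenchel operator. -/

/-- The set `f^*(X)` of slopes at which the Legendre-Fenchel transform of `f` is finite. -/
def conjDomain {k : ℕ} {X : Set (Fin k → ℝ)} (f : X → ℝ) : Set (Fin k → ℝ) :=
  {ξ | BddAbove (range fun x : X => ξ ⬝ᵥ (x : Fin k → ℝ) - f x)}

/-- The Legendre-Fenchel transform of `f : X → ℝ`; it is used only on `conjDomain f`. -/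
def legendreFenchel {k : ℕ} {X : Set (Fin k → ℝ)} (f : X → ℝ) (ξ : Fin k → ℝ) : ℝ :=
  ⨆ x : X, (ξ ⬝ᵥ (x : Fin k → ℝ) - f x)

/-- The transform over `X`, followed by the transform over `f^*(X)`. -/
def opC {k : ℕ} {X : Set (Fin k → ℝ)} (f : X → ℝ) : X → ℝ :=
  fun x => legendreFenchel (X := conjDomain f) (fun ξ => legendreFenchel f ξ) x

/-- The points of `X` are slopes at which the second transform is finite. -/
theorem mem_conjDomain_legendreFenchel {k : ℕ} {X : Set (Fin k → ℝ)} (f : X → ℝ) (x : X) :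
    (x : Fin k → ℝ) ∈ conjDomain (X := conjDomain f) (fun ξ => legendreFenchel f ξ) := by
  refine ⟨f x, ?_⟩
  rintro _ ⟨ξ, rfl⟩
  have h : (ξ : Fin k → ℝ) ⬝ᵥ (x : Fin k → ℝ) - f x ≤ legendreFenchel f ξ :=
    le_ciSup (f := fun x : X => (ξ : Fin k → ℝ) ⬝ᵥ (x : Fin k → ℝ) - f x) ξ.2 x
  have h2 := dotProduct_comm (x : Fin k → ℝ) (ξ : Fin k → ℝ)
  simp only
  linarith

theorem zero_mem_conjDomain {k : ℕ} {X : Set (Fin k → ℝ)} {f : X → ℝ} (hf : f ∈ ellInf X) :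
    0 ∈ conjDomain f := by
  obtain ⟨-, K, hK⟩ := hf
  refine ⟨K, ?_⟩
  rintro _ ⟨x, rfl⟩
  have := (abs_le.1 (hK x)).1
  simp only [zero_dotProduct]
  linarith

/-! The monotone rearrangement on the rectangle `Icc a b = [a₁,b₁] × ⋯ × [aₖ,bₖ]`. -/

/-- `{t ∈ [a_j, b_j] : f(t, x(-j)) ≤ y}`, the sublevel set of `f` along the `j`-th direction
through `x`. -/
def sliceSublevel {k : ℕ} {a b : Fin k → ℝ} (j : Fin k) (f : Icc a b → ℝ) (x : Icc a b)
    (y : ℝ) : Set ℝ :=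
  {t | ∃ h : Function.update (x : Fin k → ℝ) j t ∈ Icc a b, f ⟨_, h⟩ ≤ y}

/-- The one-dimensional increasing rearrangement in the `j`-th coordinate: the smallest level `y`
such that `{t : f(t, x(-j)) ≤ y}` has length at least `x_j - a_j`. The requirement that this set
be nonempty is automatic if `a_j < x_j`; if `x_j = a_j`, it makes the value the infimum of `f`
along the segment (without it all real `y` would be admitted). -/
def opMj {k : ℕ} {a b : Fin k → ℝ} (j : Fin k) (f : Icc a b → ℝ) : Icc a b → ℝ :=
  fun x => sInf {y : ℝ | (sliceSublevel j f x y).Nonempty ∧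
    (x : Fin k → ℝ) j - a j ≤ volume.real (sliceSublevel j f x y)}

/-- The composition `M_{π 1} ∘ ⋯ ∘ M_{π k}`. -/
def opMperm {k : ℕ} {a b : Fin k → ℝ} (π : Equiv.Perm (Fin k)) (f : Icc a b → ℝ) :
    Icc a b → ℝ :=
  (List.finRange k).foldr (fun i g => opMj (π i) g) f

/-- The average of the rearrangements over the set `P` of permutations. -/
def opM {k : ℕ} {a b : Fin k → ℝ} (P : Finset (Equiv.Perm (Fin k))) (f : Icc a b → ℝ) :
    Icc a b → ℝ :=
  fun x => (1 / (P.card : ℝ)) * ∑ π ∈ P, opMperm π f x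

/-! The quasi-convexity operator. -/

/-- The lower contour set `{x ∈ X : f x ≤ y}`, as a subset of `ℝᵏ`. -/
def lowerContour {k : ℕ} {X : Set (Fin k → ℝ)} (f : X → ℝ) (y : ℝ) : Set (Fin k → ℝ) :=
  Subtype.val '' {x : X | f x ≤ y}

/-- The levels whose lower contour set has `x` in its convex hull. -/
def hullLevels {k : ℕ} {X : Set (Fin k → ℝ)} (f : X → ℝ) (x : X) : Set ℝ :=
  {y | (x : Fin k → ℝ) ∈ convexHull ℝ (lowerContour f y)}

/-- The least element of `hullLevels f x`, written as an infimum. -/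
def opQ {k : ℕ} {X : Set (Fin k → ℝ)} (f : X → ℝ) : X → ℝ :=
  fun x => sInf (hullLevels f x)

/-! The composite operators. -/

def opMR {k : ℕ} {a b : Fin k → ℝ} (P : Finset (Equiv.Perm (Fin k))) (lo hi : ℝ)
    (f : Icc a b → ℝ) : Icc a b → ℝ := opM P (opR lo hi f)

def opCMR {k : ℕ} {a b : Fin k → ℝ} (P : Finset (Equiv.Perm (Fin k))) (lo hi : ℝ)
    (f : Icc a b → ℝ) : Icc a b → ℝ := opC (opMR P lo hi f)

def opQMR {k : ℕ} {a b : Fin k → ℝ} (P : Finset (Equiv.Perm (Fin k))) (lo hi : ℝ)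
    (f : Icc a b → ℝ) : Icc a b → ℝ := opQ (opMR P lo hi f)

end

end ShapeEnforcing

namespace ShapeEnforcing

open Set MeasureTheory Filter Topology

/-! Infima of closed level sets -/

section Levels

variable {X : Type*} [TopologicalSpace X] {G : X → Set ℝ}

/-! The rearrangements `opMj` and the operator `opQ` both have the form: least element of an upward
closed set of levels `G x`. Once the joint set of pairs `(x, y)` with `y ∈ G x` is closed, the
minimum is attained and that set is the epigraph of the operator's value, which is therefore lower
semicontinuous. Closedness comes from compactness of the box (`isClosed_rearrLevels`,
`isClosed_hullLevels`). The operator `opC` is instead a supremum of affine minorants (`opC_le_iff`).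

Order preservation and contraction both follow from one property, stable under composition: `f ≤ g +
c` with `c ≥ 0` gives `O f ≤ O g + c`. The case `c = 0` is order preservation; `c = dInf f g`, used
in both directions, is contraction.

It remains to see that `C` and `Q` do not destroy the monotonicity and range produced by `MR`. Range
bounds are immediate. Monotonicity uses the box: a minorant of a monotone function can be traded for
one with nonnegative slopes (`monotone_opC`), and lower contour sets of a monotone function are
stable under coordinatewise contraction towards `a` (`monotone_opQ`). -/

theorem isLeast_sInf_of_isClosed_levels (hG : IsClosed {p : X × ℝ | p.2 ∈ G p.1}) {x : X}
    (hne : (G x).Nonempty) (hbd : BddBelow (G x)) : IsLeast (G x) (sInf (G x)) := by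
  have : IsClosed (G x) := hG.preimage (f := fun y : ℝ => (x, y)) (by fun_prop)
  exact ⟨this.csInf_mem hne hbd, fun y hy => csInf_le hbd hy⟩

theorem lowerSemicontinuous_of_isLeast_levels (hG : IsClosed {p : X × ℝ | p.2 ∈ G p.1})
    (hup : ∀ x y y', y ∈ G x → y ≤ y' → y' ∈ G x) {F : X → ℝ}
    (hF : ∀ x, IsLeast (G x) (F x)) : LowerSemicontinuous F := by
  rw [lowerSemicontinuous_iff_isClosed_epigraph]
  convert hG using 2 with p
  ext p
  exact ⟨fun h => hup _ _ _ (hF p.1).1 h, fun h => (hF p.1).2 h⟩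

end Levels

/-! Operators compatible with order, ranges and translations -/

/-- `O f ≤ O g + c` whenever `f ≤ g + c` with `c ≥ 0`. -/
def IsShiftMonotone {k : ℕ} {X : Set (Fin k → ℝ)} (O : (X → ℝ) → (X → ℝ)) : Prop :=
  ∀ f ∈ ellS X, ∀ g ∈ ellS X, ∀ c : ℝ, 0 ≤ c → (∀ x, f x ≤ g x + c) → ∀ x, O f x ≤ O g x + c

/-- `O` maps bounded lower semicontinuous functions to such functions, preserves bounds, and is
compatible with the order and with translations. -/
structure IsShaping {k : ℕ} {X : Set (Fin k → ℝ)} (O : (X → ℝ) → (X → ℝ)) : Prop where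
  mem_ellS : ∀ f ∈ ellS X, O f ∈ ellS X
  range : ∀ f ∈ ellS X, ∀ lo hi : ℝ, (∀ x, lo ≤ f x ∧ f x ≤ hi) → ∀ x, lo ≤ O f x ∧ O f x ≤ hi
  shift : IsShiftMonotone O

theorem mem_ellS_of_bounds {k : ℕ} {X : Set (Fin k → ℝ)} {f : X → ℝ}
    (hf : LowerSemicontinuous f) {lo hi : ℝ} (h : ∀ x, lo ≤ f x ∧ f x ≤ hi) : f ∈ ellS X :=
  ⟨⟨hf.measurable, max |lo| |hi|, fun x => abs_le_max_abs_abs (h x).1 (h x).2⟩, hf⟩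

theorem exists_bounds_of_mem_ellInf {k : ℕ} {X : Set (Fin k → ℝ)} {f : X → ℝ}
    (hf : f ∈ ellInf X) : ∃ lo hi : ℝ, ∀ x, lo ≤ f x ∧ f x ≤ hi := by
  obtain ⟨-, K, hK⟩ := hf
  exact ⟨-K, K, fun x => abs_le.1 (hK x)⟩

theorem bddAbove_abs_sub {k : ℕ} {X : Set (Fin k → ℝ)} {f g : X → ℝ} (hf : f ∈ ellInf X)
    (hg : g ∈ ellInf X) : BddAbove (range fun x => |f x - g x|) := by
  obtain ⟨-, K, hK⟩ := hf
  obtain ⟨-, L, hL⟩ := hg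
  refine ⟨K + L, ?_⟩
  rintro _ ⟨x, rfl⟩
  exact (abs_sub _ _).trans (add_le_add (hK x) (hL x))

section

variable {k : ℕ} {X : Set (Fin k → ℝ)} {O O' : (X → ℝ) → (X → ℝ)}

theorem IsShaping.comp (h : IsShaping O) (h' : IsShaping O') : IsShaping fun f => O (O' f) where
  mem_ellS f hf := h.mem_ellS _ (h'.mem_ellS f hf)
  range f hf lo hi hb := h.range _ (h'.mem_ellS f hf) lo hi (h'.range f hf lo hi hb)
  shift f hf g hg c hc hfg :=
    h.shift _ (h'.mem_ellS f hf) _ (h'.mem_ellS g hg) c hc (h'.shift f hf g hg c hc hfg)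

theorem IsShiftMonotone.order_preserving (h : IsShiftMonotone O) : ∀ f ∈ ellS X, ∀ g ∈ ellS X, f ≤ g → O f ≤ O g := by
  intro f hf g hg hfg x
  simpa using h f hf g hg 0 le_rfl (fun x => by simpa using hfg x) x

theorem IsShiftMonotone.isDistContraction (h : IsShiftMonotone O) : IsDistContraction dInf (ellS X) O := by
  intro f hf g hg
  have hd : 0 ≤ dInf f g := Real.iSup_nonneg fun x => abs_nonneg _
  have hle : ∀ x, |f x - g x| ≤ dInf f g := le_ciSup (bddAbove_abs_sub hf.1 hg.1)
  refine Real.iSup_le (fun x => abs_le.2 ⟨?_, ?_⟩) hd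
  · have := h g hg f hf _ hd (fun x => by linarith [(abs_le.1 (hle x)).1]) x
    linarith
  · have := h f hf g hg _ hd (fun x => by linarith [(abs_le.1 (hle x)).2]) x
    linarith

end

/-! The range operator -/

theorem opR_mem_ellS {k : ℕ} {X : Set (Fin k → ℝ)} {lo hi : ℝ} (h : lo ≤ hi) {f : X → ℝ}
    (hf : f ∈ ellS X) : opR lo hi f ∈ ellS X := by
  refine mem_ellS_of_bounds (lo := lo) (hi := hi) ?_
    fun x => ⟨le_min (le_max_left _ _) h, min_le_right _ _⟩
  have : opR lo hi f = (fun t => min (max lo t) hi) ∘ f := rfl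
  rw [this]
  refine Continuous.comp_lowerSemicontinuous (by fun_prop) hf.2 ?_
  intro s t hst
  exact min_le_min_right _ (max_le_max_left _ hst)

theorem opR_bounds {α : Type*} {lo hi : ℝ} (h : lo ≤ hi) (f : α → ℝ) (x : α) :
    lo ≤ opR lo hi f x ∧ opR lo hi f x ≤ hi :=
  ⟨le_min (le_max_left _ _) h, min_le_right _ _⟩

/-- Truncation is not an instance of `IsShaping`: it need not respect bounds other than `lo` and
`hi`. So its shift property is proved separately. -/
theorem opR_shift {α : Type*} {lo hi c : ℝ} (hc : 0 ≤ c) {f g : α → ℝ}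
    (h : ∀ x, f x ≤ g x + c) (x : α) : opR lo hi f x ≤ opR lo hi g x + c := by
  have := h x
  simp only [opR]
  grind

theorem opR_eq_self {α : Type*} {lo hi : ℝ} {f : α → ℝ} (h : ∀ x, lo ≤ f x ∧ f x ≤ hi) :
    opR lo hi f = f := by
  ext x
  simp [opR, (h x).1, (h x).2]

/-! The monotone rearrangement -/

section Rearrangement

variable {k : ℕ} {a b : Fin k → ℝ}

/-- The levels whose infimum is the rearrangement in the `j`-th coordinate. -/
def rearrLevels (j : Fin k) (f : Icc a b → ℝ) (x : Icc a b) : Set ℝ :=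
  {y : ℝ | (sliceSublevel j f x y).Nonempty ∧
    (x : Fin k → ℝ) j - a j ≤ volume.real (sliceSublevel j f x y)}

theorem update_mem_Icc (x : Icc a b) {j : Fin k} {t : ℝ} :
    Function.update (x : Fin k → ℝ) j t ∈ Icc a b ↔ t ∈ Icc (a j) (b j) := by
  constructor
  · intro h
    simpa using And.intro (h.1 j) (h.2 j)
  · intro h
    exact ⟨le_update_iff.2 ⟨h.1, fun i _ => x.2.1 i⟩, update_le_iff.2 ⟨h.2, fun i _ => x.2.2 i⟩⟩

theorem sliceSublevel_subset (j : Fin k) (f : Icc a b → ℝ) (x : Icc a b) (y : ℝ) :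
    sliceSublevel j f x y ⊆ Icc (a j) (b j) := fun _ ⟨h, _⟩ => (update_mem_Icc x).1 h

theorem volume_ne_top_of_subset_Icc {s : Set ℝ} {c d : ℝ} (h : s ⊆ Icc c d) :
    volume s ≠ ⊤ := ((measure_mono h).trans_lt measure_Icc_lt_top).ne

theorem sliceSublevel_mono_volume {j : Fin k} {f g : Icc a b → ℝ} {x x' : Icc a b} {y y' : ℝ}
    (h : sliceSublevel j f x y ⊆ sliceSublevel j g x' y') :
    volume.real (sliceSublevel j f x y) ≤ volume.real (sliceSublevel j g x' y') :=
  measureReal_mono h (volume_ne_top_of_subset_Icc (sliceSublevel_subset j g x' y'))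

/-- The epigraph is first pushed into the ambient space, where it stays closed because the box is
closed; replacing a coordinate is continuous there but may leave the box. -/
theorem isClosed_sliceSublevel_graph (j : Fin k) {f : Icc a b → ℝ} (hf : LowerSemicontinuous f) :
    IsClosed {p : (Icc a b × ℝ) × ℝ | p.2 ∈ sliceSublevel j f p.1.1 p.1.2} := by
  have hE : IsClosed {q : (Fin k → ℝ) × ℝ | ∃ h : q.1 ∈ Icc a b, f ⟨q.1, h⟩ ≤ q.2} := by
    have hemb : IsClosedEmbedding (Prod.map Subtype.val id : Icc a b × ℝ → (Fin k → ℝ) × ℝ) :=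
      isClosed_Icc.isClosedEmbedding_subtypeVal.prodMap IsClosedEmbedding.id
    convert hemb.isClosedMap _ (lowerSemicontinuous_iff_isClosed_epigraph.1 hf) using 1
    ext ⟨z, y⟩
    constructor
    · rintro ⟨h, hy⟩
      exact ⟨(⟨z, h⟩, y), hy, rfl⟩
    · rintro ⟨⟨⟨w, hw⟩, y'⟩, h, he⟩
      simp only [Prod.map, id, Prod.mk.injEq] at he
      obtain ⟨rfl, rfl⟩ := he
      exact ⟨hw, h⟩
  exact hE.preimage (f := fun p : (Icc a b × ℝ) × ℝ =>
    (Function.update (p.1.1 : Fin k → ℝ) j p.2, p.1.2)) (by fun_prop)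

theorem isClosed_sliceSublevel (j : Fin k) {f : Icc a b → ℝ} (hf : LowerSemicontinuous f)
    (x : Icc a b) (y : ℝ) : IsClosed (sliceSublevel j f x y) :=
  (isClosed_sliceSublevel_graph j hf).preimage (f := fun t : ℝ => ((x, y), t)) (by fun_prop)

/-- Nonemptiness passes to limits by compactness of `[a_j, b_j]`. The length condition passes by a
reverse Fatou argument: the limsup of the slices lies in the limit slice, and lengths of the
decreasing tail unions converge to the length of that limsup. -/
theorem isClosed_rearrLevels (j : Fin k) {f : Icc a b → ℝ} (hf : LowerSemicontinuous f) :
    IsClosed {p : Icc a b × ℝ | p.2 ∈ rearrLevels j f p.1} := by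
  have hT := isClosed_sliceSublevel_graph j hf
  refine IsSeqClosed.isClosed fun u p hu hp => ⟨?_, ?_⟩
  · choose t ht using fun n => (hu n).1
    obtain ⟨s, -, φ, hφ, hs⟩ := isCompact_Icc.tendsto_subseq
      fun n => sliceSublevel_subset j f _ _ (ht n)
    refine ⟨s, hT.mem_of_tendsto (f := fun n => (u (φ n), t (φ n))) (b := atTop)
      (x := (p, s)) ?_ (Eventually.of_forall fun n => ht (φ n))⟩
    exact (hp.comp hφ.tendsto_atTop).prodMk_nhds hs
  · set S : ℕ → Set ℝ := fun n => sliceSublevel j f (u n).1 (u n).2 with hS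
    set A : ℕ → Set ℝ := fun N => ⋃ n ≥ N, S n with hA
    have hsub : ∀ N, A N ⊆ Icc (a j) (b j) := fun N =>
      iUnion₂_subset fun n _ => sliceSublevel_subset j f _ _
    have hanti : Antitone A := fun N M h =>
      iUnion₂_subset fun n hn => subset_iUnion₂_of_subset n (h.trans hn) le_rfl
    have hmeas : ∀ N, MeasurableSet (A N) := fun N =>
      MeasurableSet.iUnion fun n => MeasurableSet.iUnion fun _ =>
        (isClosed_sliceSublevel j hf _ _).measurableSet
    have hlim : Tendsto (fun N => volume.real (A N)) atTop (𝓝 (volume.real (⋂ N, A N))) :=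
      (ENNReal.tendsto_toReal (volume_ne_top_of_subset_Icc
        ((iInter_subset A 0).trans (hsub 0)))).comp
        (tendsto_measure_iInter_atTop (fun N => (hmeas N).nullMeasurableSet) hanti
          ⟨0, volume_ne_top_of_subset_Icc (hsub 0)⟩)
    have hinter : ⋂ N, A N ⊆ sliceSublevel j f p.1 p.2 := by
      intro t ht
      -- A point of every tail union lies in infinitely many slices; closedness of the graph then
      -- puts it in the limit slice.
      have hfreq : ∃ᶠ n in atTop, (u n, t) ∈
          {p : (Icc a b × ℝ) × ℝ | p.2 ∈ sliceSublevel j f p.1.1 p.1.2} := by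
        rw [frequently_atTop]
        intro N
        have := mem_iInter.1 ht N
        simpa [hA, hS] using this
      exact hT.mem_of_frequently_of_tendsto (x := (p, t)) hfreq (hp.prodMk_nhds tendsto_const_nhds)
    have hx : Tendsto (fun n => ((u n).1 : Fin k → ℝ) j - a j) atTop
        (𝓝 ((p.1 : Fin k → ℝ) j - a j)) := by
      have hc : Continuous fun q : Icc a b × ℝ => (q.1 : Fin k → ℝ) j - a j :=
        ((continuous_apply j).comp (continuous_subtype_val.comp continuous_fst)).sub
          continuous_const
      exact (hc.tendsto p).comp hp
    refine (le_of_tendsto_of_tendsto' hx hlim fun n => (hu n).2.trans ?_).trans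
      (measureReal_mono hinter (volume_ne_top_of_subset_Icc (sliceSublevel_subset j f _ _)))
    exact measureReal_mono (subset_iUnion₂_of_subset n le_rfl le_rfl)
      (volume_ne_top_of_subset_Icc (hsub n))

theorem rearrLevels_shift {j : Fin k} {f g : Icc a b → ℝ} {c : ℝ} (h : ∀ x, f x ≤ g x + c)
    {x : Icc a b} {y : ℝ} (hy : y ∈ rearrLevels j g x) : y + c ∈ rearrLevels j f x := by
  have hsub : sliceSublevel j g x y ⊆ sliceSublevel j f x (y + c) := by
    rintro t ⟨ht, hty⟩
    exact ⟨ht, (h _).trans (by linarith)⟩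
  exact ⟨hy.1.mono hsub, hy.2.trans (sliceSublevel_mono_volume hsub)⟩

theorem rearrLevels_upward {j : Fin k} {f : Icc a b → ℝ} (x : Icc a b) (y y' : ℝ)
    (hy : y ∈ rearrLevels j f x) (h : y ≤ y') : y' ∈ rearrLevels j f x := by
  have := rearrLevels_shift (c := y' - y) (f := f) (fun x => by linarith) hy
  simpa using this

theorem le_of_mem_rearrLevels {j : Fin k} {f : Icc a b → ℝ} {lo : ℝ} (h : ∀ x, lo ≤ f x)
    {x : Icc a b} {y : ℝ} (hy : y ∈ rearrLevels j f x) : lo ≤ y := by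
  obtain ⟨⟨t, ht, hty⟩, -⟩ := hy
  exact (h _).trans hty

/-- The slice contains `[a_j, x_j]`, which has exactly the required length. -/
theorem mem_rearrLevels_of_le {j : Fin k} {f : Icc a b → ℝ} {x : Icc a b} {y : ℝ}
    (h : ∀ (t : ℝ) (ht : Function.update (x : Fin k → ℝ) j t ∈ Icc a b),
      t ≤ (x : Fin k → ℝ) j → f ⟨_, ht⟩ ≤ y) :
    y ∈ rearrLevels j f x := by
  have hsub : Icc (a j) ((x : Fin k → ℝ) j) ⊆ sliceSublevel j f x y := by
    intro t ht
    have := (update_mem_Icc x).2 ⟨ht.1, ht.2.trans (x.2.2 j)⟩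
    exact ⟨this, h t this ht.2⟩
  refine ⟨⟨_, hsub ⟨x.2.1 j, le_rfl⟩⟩, ?_⟩
  have := measureReal_mono hsub (volume_ne_top_of_subset_Icc (sliceSublevel_subset j f x y))
  rwa [Real.volume_real_Icc_of_le (x.2.1 j)] at this

theorem isLeast_opMj (j : Fin k) {f : Icc a b → ℝ} (hf : f ∈ ellS (Icc a b)) (x : Icc a b) :
    IsLeast (rearrLevels j f x) (opMj j f x) := by
  obtain ⟨lo, hi, hb⟩ := exists_bounds_of_mem_ellInf hf.1
  exact isLeast_sInf_of_isClosed_levels (isClosed_rearrLevels j hf.2)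
    ⟨hi, mem_rearrLevels_of_le fun _ _ _ => (hb _).2⟩
    ⟨lo, fun _ hy => le_of_mem_rearrLevels (fun x => (hb x).1) hy⟩

theorem opMj_bounds (j : Fin k) {f : Icc a b → ℝ} (hf : f ∈ ellS (Icc a b)) (lo hi : ℝ)
    (hb : ∀ x, lo ≤ f x ∧ f x ≤ hi) (x : Icc a b) : lo ≤ opMj j f x ∧ opMj j f x ≤ hi :=
  ⟨le_of_mem_rearrLevels (fun x => (hb x).1) (isLeast_opMj j hf x).1,
    (isLeast_opMj j hf x).2 (mem_rearrLevels_of_le fun _ _ _ => (hb _).2)⟩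

theorem isShaping_opMj (j : Fin k) : IsShaping (opMj (a := a) (b := b) j) where
  mem_ellS f hf := by
    obtain ⟨lo, hi, hb⟩ := exists_bounds_of_mem_ellInf hf.1
    exact mem_ellS_of_bounds (lowerSemicontinuous_of_isLeast_levels (isClosed_rearrLevels j hf.2)
      rearrLevels_upward (isLeast_opMj j hf)) (opMj_bounds j hf lo hi hb)
  range f hf lo hi hb := opMj_bounds j hf lo hi hb
  shift f hf g hg c _ h x :=
    (isLeast_opMj j hf x).2 (rearrLevels_shift h (isLeast_opMj j hg x).1)

theorem opMj_eq_self (j : Fin k) {f : Icc a b → ℝ} (hf : f ∈ ellS (Icc a b)) (hm : Monotone f) :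
    opMj j f = f := by
  ext x
  refine (isLeast_opMj j hf x).unique ⟨mem_rearrLevels_of_le fun t ht htx => hm ?_, ?_⟩
  · exact Subtype.mk_le_mk.2 (update_le_self_iff.2 htx)
  · rintro y ⟨hne, hvol⟩
    have hcpt : IsCompact (sliceSublevel j f x y) :=
      isCompact_Icc.of_isClosed_subset (isClosed_sliceSublevel j hf.2 x y)
        (sliceSublevel_subset j f x y)
    -- The slice lies in `[a_j, s]`, so its length forces `x_j ≤ s`; monotonicity then bounds `f x`
    -- by the value at `s`, which is at most `y`.
    obtain ⟨s, hs, hmax⟩ := hcpt.exists_isGreatest hne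
    have hs' := sliceSublevel_subset j f x y hs
    have hsub : sliceSublevel j f x y ⊆ Icc (a j) s :=
      fun t ht => ⟨(sliceSublevel_subset j f x y ht).1, hmax ht⟩
    have := measureReal_mono hsub (volume_ne_top_of_subset_Icc le_rfl)
    rw [Real.volume_real_Icc_of_le hs'.1] at this
    obtain ⟨h, hy⟩ := hs
    refine (hm ?_).trans hy
    exact Subtype.mk_le_mk.2 (le_update_self_iff.2 (by linarith))

/-- `f` is nondecreasing in the coordinates in `J`. -/
def MonotoneIn (J : Set (Fin k)) (f : Icc a b → ℝ) : Prop :=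
  ∀ x x' : Icc a b, x ≤ x' → (∀ l ∉ J, (x : Fin k → ℝ) l = (x' : Fin k → ℝ) l) → f x ≤ f x'

/-- Coordinate `j` is overwritten in a slice, so lowering the point enlarges the slice by
monotonicity in `J`, while the length demanded shrinks. Thus `j` is gained and no earlier coordinate
is lost. -/
theorem MonotoneIn.opMj {J : Set (Fin k)} {j : Fin k} {f : Icc a b → ℝ}
    (hf : f ∈ ellS (Icc a b)) (h : MonotoneIn J f) : MonotoneIn (insert j J) (opMj j f) := by
  intro x x' hxx' hoff
  refine (isLeast_opMj j hf x).2 ?_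
  obtain ⟨hne, hvol⟩ := (isLeast_opMj j hf x').1
  set y := ShapeEnforcing.opMj j f x'
  have hsub : sliceSublevel j f x' y ⊆ sliceSublevel j f x y := by
    rintro t ⟨ht, hty⟩
    have ht' := (update_mem_Icc x).2 ((update_mem_Icc x').1 ht)
    refine ⟨ht', (h _ _ ?_ ?_).trans hty⟩
    · exact Subtype.mk_le_mk.2 (update_le_update_iff.2 ⟨le_rfl, fun i _ => hxx' i⟩)
    · intro l hl
      by_cases hlj : l = j
      · subst hlj; simp
      · simpa [hlj] using hoff l (by simp [hlj, hl])
  refine ⟨hne.mono hsub, ?_⟩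
  have : (x : Fin k → ℝ) j ≤ (x' : Fin k → ℝ) j := hxx' j
  linarith [sliceSublevel_mono_volume hsub]

theorem foldr_opMj (l : List (Fin k)) (π : Fin k → Fin k) :
    IsShaping (fun f : Icc a b → ℝ => l.foldr (fun i g => opMj (π i) g) f) ∧
    (∀ f ∈ ellS (Icc a b), Monotone f → l.foldr (fun i g => opMj (π i) g) f = f) ∧
    ∀ f ∈ ellS (Icc a b), MonotoneIn (π '' {i | i ∈ l}) (l.foldr (fun i g => opMj (π i) g) f) := by
  induction l with
  | nil =>
    refine ⟨⟨fun f hf => hf, fun f hf lo hi h => h, fun f hf g hg c _ h => h⟩,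
      fun f hf _ => rfl, fun f hf x x' _ h => ?_⟩
    have : x = x' := Subtype.ext (funext fun l => h l (by simp))
    rw [this]
  | cons i l ih =>
    obtain ⟨h1, h2, h3⟩ := ih
    refine ⟨(isShaping_opMj (π i)).comp h1, fun f hf hm => ?_, fun f hf => ?_⟩
    · simp only [List.foldr_cons, h2 f hf hm, opMj_eq_self _ hf hm]
    · have hset : π '' {i' | i' ∈ i :: l} = insert (π i) (π '' {i | i ∈ l}) := by
        ext j
        simp [eq_comm]
      rw [hset]
      exact (h3 f hf).opMj (h1.mem_ellS f hf)

theorem isShaping_opMperm (π : Equiv.Perm (Fin k)) : IsShaping (opMperm (a := a) (b := b) π) :=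
  (foldr_opMj _ π).1

theorem opMperm_eq_self (π : Equiv.Perm (Fin k)) {f : Icc a b → ℝ} (hf : f ∈ ellS (Icc a b))
    (hm : Monotone f) : opMperm π f = f :=
  (foldr_opMj _ π).2.1 f hf hm

theorem monotone_opMperm (π : Equiv.Perm (Fin k)) {f : Icc a b → ℝ} (hf : f ∈ ellS (Icc a b)) :
    Monotone (opMperm π f) := fun x x' h =>
  -- A permutation is surjective, so no coordinate is left unsorted.
  (foldr_opMj (List.finRange k) π).2.2 f hf x x' h fun l hl =>
    absurd ⟨π.symm l, by simp, by simp⟩ hl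

variable {P : Finset (Equiv.Perm (Fin k))}

theorem opM_le_of_forall {f : Icc a b → ℝ} {x : Icc a b} {y : ℝ} (hP : P.Nonempty)
    (h : ∀ π ∈ P, opMperm π f x ≤ y) : opM P f x ≤ y := by
  have hc : (0 : ℝ) < P.card := by exact_mod_cast hP.card_pos
  rw [opM, one_div, inv_mul_le_iff₀ hc]
  simpa using Finset.sum_le_card_nsmul P _ y h

theorem le_opM_of_forall {f : Icc a b → ℝ} {x : Icc a b} {y : ℝ} (hP : P.Nonempty)
    (h : ∀ π ∈ P, y ≤ opMperm π f x) : y ≤ opM P f x := by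
  have hc : (0 : ℝ) < P.card := by exact_mod_cast hP.card_pos
  rw [opM, one_div, le_inv_mul_iff₀ hc]
  simpa using Finset.card_nsmul_le_sum P _ y h

theorem isShaping_opM (hP : P.Nonempty) : IsShaping (opM (a := a) (b := b) P) := by
  have hc : (0 : ℝ) < P.card := by exact_mod_cast hP.card_pos
  have hr : ∀ f ∈ ellS (Icc a b), ∀ lo hi : ℝ, (∀ x, lo ≤ f x ∧ f x ≤ hi) →
      ∀ x, lo ≤ opM P f x ∧ opM P f x ≤ hi := fun f hf lo hi hb x =>
    ⟨le_opM_of_forall hP fun π _ => ((isShaping_opMperm π).range f hf lo hi hb x).1,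
      opM_le_of_forall hP fun π _ => ((isShaping_opMperm π).range f hf lo hi hb x).2⟩
  refine ⟨fun f hf => ?_, hr, fun f hf g hg c hc0 h x => ?_⟩
  · obtain ⟨lo, hi, hb⟩ := exists_bounds_of_mem_ellInf hf.1
    refine mem_ellS_of_bounds ?_ (hr f hf lo hi hb)
    have hsum : LowerSemicontinuous fun x => ∑ π ∈ P, opMperm π f x :=
      lowerSemicontinuous_sum fun π _ => ((isShaping_opMperm π).mem_ellS f hf).2
    exact Continuous.comp_lowerSemicontinuous (g := fun t : ℝ => 1 / (P.card : ℝ) * t)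
      (by fun_prop) hsum fun s t hst => by dsimp only; gcongr
  · have : ∑ π ∈ P, opMperm π f x ≤ ∑ π ∈ P, opMperm π g x + P.card * c := by
      rw [← nsmul_eq_mul, ← Finset.sum_const, ← Finset.sum_add_distrib]
      exact Finset.sum_le_sum fun π _ => (isShaping_opMperm π).shift f hf g hg c hc0 h x
    calc opM P f x ≤ 1 / (P.card : ℝ) * (∑ π ∈ P, opMperm π g x + P.card * c) := by
          unfold opM; gcongr
      _ = opM P g x + c := by unfold opM; field_simp

theorem opM_eq_self (hP : P.Nonempty) {f : Icc a b → ℝ} (hf : f ∈ ellS (Icc a b))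
    (hm : Monotone f) : opM P f = f := by
  ext x
  exact le_antisymm (opM_le_of_forall hP fun π _ => (congrFun (opMperm_eq_self π hf hm) x).le)
    (le_opM_of_forall hP fun π _ => (congrFun (opMperm_eq_self π hf hm) x).ge)

theorem monotone_opM {f : Icc a b → ℝ} (hf : f ∈ ellS (Icc a b)) : Monotone (opM P f) := by
  intro x x' h
  unfold opM
  gcongr with π _
  exact monotone_opMperm π hf h

end Rearrangement

/-! The double Legendre-Fenchel operator -/

section Biconjugate

variable {k : ℕ} {a b : Fin k → ℝ}

/-- Linear forms are bounded on the compact box, so the second transform ranges over all slopes. -/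
theorem mem_conjDomain_of_mem_ellInf {f : Icc a b → ℝ} (hf : f ∈ ellInf (Icc a b))
    (ξ : Fin k → ℝ) : ξ ∈ conjDomain f := by
  obtain ⟨lo, hi, hb⟩ := exists_bounds_of_mem_ellInf hf
  obtain ⟨C, hC⟩ := (isCompact_Icc (a := a) (b := b)).bddAbove_image
    (f := fun x => ξ ⬝ᵥ x) (by unfold dotProduct; fun_prop)
  refine ⟨C - lo, ?_⟩
  rintro _ ⟨x, rfl⟩
  have h1 : ξ ⬝ᵥ (x : Fin k → ℝ) ≤ C := hC ⟨x, x.2, rfl⟩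
  have h2 := (hb x).1
  dsimp only
  linarith

/-- `opC f` is the pointwise supremum of the affine functions below `f`. -/
theorem opC_le_iff {f : Icc a b → ℝ} (hf : f ∈ ellInf (Icc a b)) {x : Icc a b} {y : ℝ} :
    opC f x ≤ y ↔ ∀ (ξ : Fin k → ℝ) (d : ℝ), (∀ z : Icc a b, ξ ⬝ᵥ (z : Fin k → ℝ) + d ≤ f z) →
      ξ ⬝ᵥ (x : Fin k → ℝ) + d ≤ y := by
  have : Nonempty (conjDomain f) := ⟨⟨0, zero_mem_conjDomain hf⟩⟩
  have : Nonempty (Icc a b) := ⟨x⟩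
  rw [opC, legendreFenchel, ciSup_le_iff (mem_conjDomain_legendreFenchel f x)]
  constructor
  · intro h ξ d hξ
    have h1 := h ⟨ξ, mem_conjDomain_of_mem_ellInf hf ξ⟩
    have h2 : legendreFenchel f ξ ≤ -d := ciSup_le fun z => by linarith [hξ z]
    have h3 := dotProduct_comm (x : Fin k → ℝ) ξ
    dsimp only at h1
    linarith
  · intro h ξ
    have h1 := h ξ (-legendreFenchel f ξ) fun z => by
      have : (ξ : Fin k → ℝ) ⬝ᵥ (z : Fin k → ℝ) - f z ≤ legendreFenchel f ξ := le_ciSup ξ.2 z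
      linarith
    have h3 := dotProduct_comm (x : Fin k → ℝ) ξ
    linarith

theorem affine_le_opC {f : Icc a b → ℝ} (hf : f ∈ ellInf (Icc a b)) {ξ : Fin k → ℝ} {d : ℝ}
    (h : ∀ z : Icc a b, ξ ⬝ᵥ (z : Fin k → ℝ) + d ≤ f z) (x : Icc a b) :
    ξ ⬝ᵥ (x : Fin k → ℝ) + d ≤ opC f x :=
  (opC_le_iff hf).1 le_rfl ξ d h

theorem opC_le_self {f : Icc a b → ℝ} (hf : f ∈ ellInf (Icc a b)) (x : Icc a b) :
    opC f x ≤ f x :=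
  (opC_le_iff hf).2 fun _ _ h => h x

theorem lowerSemicontinuous_opC (f : Icc a b → ℝ) : LowerSemicontinuous (opC f) := by
  refine lowerSemicontinuous_ciSup (fun x => mem_conjDomain_legendreFenchel f x) fun ξ => ?_
  refine Continuous.lowerSemicontinuous (Continuous.sub ?_ continuous_const)
  exact continuous_finsetSum _ fun i _ =>
    ((continuous_apply i).comp continuous_subtype_val).mul continuous_const

theorem isShaping_opC : IsShaping (opC (X := Icc a b)) := by
  have hr : ∀ f ∈ ellS (Icc a b), ∀ lo hi : ℝ, (∀ x, lo ≤ f x ∧ f x ≤ hi) →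
      ∀ x, lo ≤ opC f x ∧ opC f x ≤ hi := fun f hf lo hi hb x =>
    ⟨by simpa using affine_le_opC hf.1 (ξ := 0) (d := lo) (fun z => by simpa using (hb z).1) x,
      (opC_le_self hf.1 x).trans (hb x).2⟩
  refine ⟨fun f hf => ?_, hr, fun f hf g hg c _ h x => ?_⟩
  · obtain ⟨lo, hi, hb⟩ := exists_bounds_of_mem_ellInf hf.1
    exact mem_ellS_of_bounds (lowerSemicontinuous_opC f) (hr f hf lo hi hb)
  · refine (opC_le_iff hf.1).2 fun ξ d hξ => ?_
    have := affine_le_opC hg.1 (ξ := ξ) (d := d - c) (fun z => by linarith [hξ z, h z]) x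
    linarith

theorem opC_mem_ellC {f : Icc a b → ℝ} (hf : f ∈ ellS (Icc a b)) : opC f ∈ ellC (Icc a b) := by
  refine ⟨isShaping_opC.mem_ellS f hf, fun x x' z α h0 h1 hz => ?_⟩
  refine (opC_le_iff hf.1).2 fun ξ d hξ => ?_
  have hx := mul_le_mul_of_nonneg_left (affine_le_opC hf.1 hξ x) h0
  have hx' := mul_le_mul_of_nonneg_left (affine_le_opC hf.1 hξ x') (sub_nonneg.2 h1)
  rw [hz, dotProduct_add, dotProduct_smul, dotProduct_smul, smul_eq_mul, smul_eq_mul]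
  linarith

/-- Any affine minorant with slope `ξ` yields one with slope `ξ⁺` whose value at `x'` is at least
the old value at `x`. -/
theorem monotone_opC {f : Icc a b → ℝ} (hf : f ∈ ellInf (Icc a b)) (hm : Monotone f) :
    Monotone (opC f) := by
  intro x x' hxx'
  refine (opC_le_iff hf).2 fun ξ d hξ => ?_
  set ν : Fin k → ℝ := fun j => min (ξ j) 0 with hν
  set ξp : Fin k → ℝ := fun j => max (ξ j) 0 with hξp
  have hlow : ∀ z : Icc a b, ξp ⬝ᵥ (z : Fin k → ℝ) + (ν ⬝ᵥ a + d) ≤ f z := by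
    intro z
    -- Moving the coordinates of negative slope down to `a` does not increase `f`, so the old bound
    -- at `z'` is a bound at `z` whose negative slopes contribute only a constant.
    set z' : Fin k → ℝ := fun j => if ξ j < 0 then a j else (z : Fin k → ℝ) j with hz'
    have hle : z' ≤ z := by
      intro j
      by_cases h : ξ j < 0
      · simpa [hz', h] using z.2.1 j
      · simp [hz', h]
    have hge : a ≤ z' := by
      intro j
      by_cases h : ξ j < 0
      · simp [hz', h]
      · simpa [hz', h] using z.2.1 j
    have hmem : z' ∈ Icc a b := ⟨hge, hle.trans z.2.2⟩
    have h1 := (hξ ⟨z', hmem⟩).trans (hm (a := ⟨z', hmem⟩) (b := z) hle)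
    have h2 : ξ ⬝ᵥ z' = ξp ⬝ᵥ (z : Fin k → ℝ) + ν ⬝ᵥ a := by
      simp only [dotProduct, ← Finset.sum_add_distrib]
      refine Finset.sum_congr rfl fun j _ => ?_
      by_cases h : ξ j < 0
      · simp [hz', hν, hξp, h, h.le]
      · simp [hz', hν, hξp, h, not_lt.1 h]
    dsimp only at h1
    linarith
  have h3 : ξ ⬝ᵥ (x : Fin k → ℝ) ≤ ξp ⬝ᵥ (x' : Fin k → ℝ) + ν ⬝ᵥ a := by
    simp only [dotProduct, ← Finset.sum_add_distrib]
    refine Finset.sum_le_sum fun j _ => ?_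
    have hj : (x : Fin k → ℝ) j ≤ (x' : Fin k → ℝ) j := hxx' j
    have e1 : ξp j * (x : Fin k → ℝ) j ≤ ξp j * (x' : Fin k → ℝ) j :=
      mul_le_mul_of_nonneg_left hj (le_max_right _ _)
    have e2 : ν j * (x : Fin k → ℝ) j ≤ ν j * a j :=
      mul_le_mul_of_nonpos_left (x.2.1 j) (min_le_right _ _)
    have e3 : ξ j = ξp j + ν j := by simp [hξp, hν, max_add_min]
    rw [e3, add_mul]
    linarith
  linarith [affine_le_opC hf hlow x']

/-- Fenchel–Moreau: a convex lower semicontinuous function has affine minorants reaching any value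
below it at a given point. -/
theorem opC_eq_self {f : Icc a b → ℝ} (hf : f ∈ ellC (Icc a b)) : opC f = f := by
  classical
  ext x
  refine le_antisymm (opC_le_self hf.1.1 x) (le_of_forall_lt fun c hc => ?_)
  set φ : (Fin k → ℝ) → ℝ := fun z => if h : z ∈ Icc a b then f ⟨z, h⟩ else 0 with hφ
  have hφf : ∀ z : Icc a b, φ z = f z := fun z => dif_pos z.2
  have hlsc : LowerSemicontinuousOn φ (Icc a b) := by
    rw [← lowerSemicontinuous_restrict_iff]
    convert hf.1.2 using 1
    ext z
    exact hφf z
  have hconv : ConvexOn ℝ (Icc a b) φ := by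
    refine ⟨convex_Icc a b, fun z hz z' hz' α β hα hβ hαβ => ?_⟩
    have hβ' : β = 1 - α := by linarith
    subst hβ'
    have hmem := convex_Icc a b hz hz' hα hβ hαβ
    have := hf.2 ⟨z, hz⟩ ⟨z', hz'⟩ ⟨_, hmem⟩ α hα (by linarith) rfl
    rw [hφf ⟨_, hmem⟩, hφf ⟨z, hz⟩, hφf ⟨z', hz'⟩]
    exact this
  obtain ⟨c', hcc', hc'⟩ := exists_between hc
  obtain ⟨l, d, hle, heq⟩ := ConvexOn.exists_affine_le_of_lt (𝕜 := ℝ) (s := Icc a b) x.2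
    (a := c') (by rwa [hφf]) isClosed_Icc hlsc hconv
  have hl : ∀ z : Fin k → ℝ, (fun j => l (Pi.single j 1)) ⬝ᵥ z = l z := by
    intro z
    have := LinearMap.pi_apply_eq_sum_univ (l : (Fin k → ℝ) →ₗ[ℝ] ℝ) z
    simp only [ContinuousLinearMap.coe_coe, smul_eq_mul] at this
    rw [this, dotProduct]
    refine Finset.sum_congr rfl fun j _ => ?_
    rw [mul_comm]
    congr 2
    ext i
    simp [Pi.single_apply, eq_comm]
  have := affine_le_opC hf.1.1 (ξ := fun j => l (Pi.single j 1)) (d := d) (fun z => by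
    rw [hl, ← hφf]
    simpa using hle z) x
  rw [hl] at this
  simp only [RCLike.re_to_real] at heq
  linarith

end Biconjugate

/-! The quasi-convexity operator -/

section QuasiConvex

variable {k : ℕ} {a b : Fin k → ℝ}

/-- Carathéodory with exactly `k + 1` points, padded by zero weights, so that the weights and points
range over one fixed compact space. -/
theorem mem_convexHull_iff_exists_fin {s : Set (Fin k → ℝ)} {x : Fin k → ℝ} :
    x ∈ convexHull ℝ s ↔ ∃ w ∈ stdSimplex ℝ (Fin (k + 1)), ∃ z : Fin (k + 1) → Fin k → ℝ,
      (∀ i, z i ∈ s) ∧ ∑ i, w i • z i = x := by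
  constructor
  · intro hx
    obtain ⟨ι, _, z, w, hz, hind, hw, hsum, hcomb⟩ := eq_pos_convex_span_of_mem_convexHull hx
    obtain ⟨z₀, hz₀⟩ := convexHull_nonempty_iff.1 ⟨x, hx⟩
    have hcard : Fintype.card ι ≤ Fintype.card (Fin (k + 1)) := by
      have h1 := hind.card_le_finrank_succ
      have h2 := Submodule.finrank_le (vectorSpan ℝ (range z))
      rw [Module.finrank_fin_fun] at h2
      rw [Fintype.card_fin]
      omega
    obtain ⟨e⟩ := Function.Embedding.nonempty_of_card_le hcard
    have hz' : ∀ i, Function.extend e z (fun _ => z₀) i ∈ s := by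
      intro i
      by_cases hi : ∃ j, e j = i
      · obtain ⟨j, rfl⟩ := hi
        rw [e.injective.extend_apply]
        exact hz ⟨j, rfl⟩
      · rw [Function.extend_apply' _ _ _ hi]
        exact hz₀
    refine ⟨Function.extend e w 0, ⟨fun i => ?_, ?_⟩, Function.extend e z fun _ => z₀, hz', ?_⟩
    · by_cases hi : ∃ j, e j = i
      · obtain ⟨j, rfl⟩ := hi
        rw [e.injective.extend_apply]
        exact (hw j).le
      · rw [Function.extend_apply' _ _ _ hi]
        rfl
    · rw [← hsum]
      refine (Fintype.sum_of_injective e e.injective _ _ (fun i hi => ?_) fun i => ?_).symm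
      · rw [Function.extend_apply' _ _ _ hi]
        rfl
      · rw [e.injective.extend_apply]
    · rw [← hcomb]
      refine (Fintype.sum_of_injective e e.injective _ _ (fun i hi => ?_) fun i => ?_).symm
      · rw [Function.extend_apply' _ _ _ hi]
        simp
      · rw [e.injective.extend_apply, e.injective.extend_apply]
  · rintro ⟨w, hw, z, hz, rfl⟩
    exact mem_convexHull_of_exists_fintype w z hw.1 hw.2 hz rfl

/-- The graph is the projection of a closed set along the compact factor of weights and points. -/
theorem isClosed_hullLevels {f : Icc a b → ℝ} (hf : LowerSemicontinuous f) :
    IsClosed {p : Icc a b × ℝ | p.2 ∈ hullLevels f p.1} := by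
  have hE := lowerSemicontinuous_iff_isClosed_epigraph.1 hf
  have : CompactSpace (stdSimplex ℝ (Fin (k + 1))) :=
    isCompact_iff_compactSpace.1 (isCompact_stdSimplex ℝ (Fin (k + 1)))
  set T : Set ((stdSimplex ℝ (Fin (k + 1)) × (Fin (k + 1) → Icc a b)) × (Icc a b × ℝ)) :=
    {q | ∑ i, (q.1.1 : Fin (k + 1) → ℝ) i • (q.1.2 i : Fin k → ℝ) = q.2.1} ∩
      ⋂ i, {q | f (q.1.2 i) ≤ q.2.2} with hT
  have hTc : IsClosed T := by
    refine IsClosed.inter (isClosed_eq ?_ ?_) (isClosed_iInter fun i => ?_)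
    · refine continuous_finsetSum _ fun i _ =>
        Continuous.smul (f := fun q : (stdSimplex ℝ (Fin (k + 1)) × (Fin (k + 1) → Icc a b)) ×
          (Icc a b × ℝ) => (q.1.1 : Fin (k + 1) → ℝ) i) ?_ ?_
      · exact (continuous_apply i).comp
          (continuous_subtype_val.comp (continuous_fst.comp continuous_fst))
      · exact continuous_subtype_val.comp
          ((continuous_apply i).comp (continuous_snd.comp continuous_fst))
    · exact continuous_subtype_val.comp (continuous_fst.comp continuous_snd)
    · exact hE.preimage (f := fun q : (stdSimplex ℝ (Fin (k + 1)) × (Fin (k + 1) → Icc a b)) ×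
        (Icc a b × ℝ) => (q.1.2 i, q.2.2)) (by fun_prop)
  convert isClosedMap_snd_of_compactSpace _ hTc using 1
  ext ⟨x, y⟩
  simp only [hullLevels, mem_ofPred_eq, mem_convexHull_iff_exists_fin]
  constructor
  · rintro ⟨w, hw, z, hz, h⟩
    choose z' hz' he using hz
    have h' : ∑ i, w i • (z' i : Fin k → ℝ) = x := by simpa only [he] using h
    exact ⟨((⟨w, hw⟩, z'), (x, y)), ⟨h', mem_iInter.2 fun i => hz' i⟩, rfl⟩
  · rintro ⟨⟨⟨w, z⟩, p⟩, ⟨h1, h2⟩, rfl⟩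
    exact ⟨w, w.2, fun i => z i, fun i => ⟨z i, mem_iInter.1 h2 i, rfl⟩, h1⟩

theorem hullLevels_shift {f g : Icc a b → ℝ} {c : ℝ} (h : ∀ x, f x ≤ g x + c) {x : Icc a b}
    {y : ℝ} (hy : y ∈ hullLevels g x) : y + c ∈ hullLevels f x :=
  convexHull_mono (image_mono fun z (hz : g z ≤ y) => (h z).trans (by linarith)) hy

theorem hullLevels_upward {f : Icc a b → ℝ} (x : Icc a b) (y y' : ℝ)
    (hy : y ∈ hullLevels f x) (h : y ≤ y') : y' ∈ hullLevels f x := by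
  have := hullLevels_shift (c := y' - y) (f := f) (fun x => by linarith) hy
  simpa using this

theorem le_of_mem_hullLevels {f : Icc a b → ℝ} {lo : ℝ} (h : ∀ x, lo ≤ f x) {x : Icc a b}
    {y : ℝ} (hy : y ∈ hullLevels f x) : lo ≤ y := by
  obtain ⟨_, z, hz, -⟩ := convexHull_nonempty_iff.1 ⟨_, hy⟩
  exact (h z).trans hz

theorem mem_hullLevels_of_le {f : Icc a b → ℝ} {x : Icc a b} {y : ℝ} (h : f x ≤ y) :
    y ∈ hullLevels f x :=
  subset_convexHull ℝ _ ⟨x, h, rfl⟩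

theorem isLeast_opQ {f : Icc a b → ℝ} (hf : f ∈ ellS (Icc a b)) (x : Icc a b) :
    IsLeast (hullLevels f x) (opQ f x) := by
  obtain ⟨lo, hi, hb⟩ := exists_bounds_of_mem_ellInf hf.1
  exact isLeast_sInf_of_isClosed_levels (isClosed_hullLevels hf.2)
    ⟨hi, mem_hullLevels_of_le (hb x).2⟩ ⟨lo, fun _ hy => le_of_mem_hullLevels (fun x => (hb x).1) hy⟩

theorem isShaping_opQ : IsShaping (opQ (X := Icc a b)) := by
  have hr : ∀ f ∈ ellS (Icc a b), ∀ lo hi : ℝ, (∀ x, lo ≤ f x ∧ f x ≤ hi) →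
      ∀ x, lo ≤ opQ f x ∧ opQ f x ≤ hi := fun f hf lo hi hb x =>
    ⟨le_of_mem_hullLevels (fun x => (hb x).1) (isLeast_opQ hf x).1,
      (isLeast_opQ hf x).2 (mem_hullLevels_of_le (hb x).2)⟩
  refine ⟨fun f hf => ?_, hr, fun f hf g hg c _ h x => ?_⟩
  · obtain ⟨lo, hi, hb⟩ := exists_bounds_of_mem_ellInf hf.1
    exact mem_ellS_of_bounds (lowerSemicontinuous_of_isLeast_levels (isClosed_hullLevels hf.2)
      hullLevels_upward (isLeast_opQ hf)) (hr f hf lo hi hb)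
  · exact (isLeast_opQ hf x).2 (hullLevels_shift h (isLeast_opQ hg x).1)

theorem opQ_mem_ellQ {f : Icc a b → ℝ} (hf : f ∈ ellS (Icc a b)) : opQ f ∈ ellQ (Icc a b) := by
  refine ⟨isShaping_opQ.mem_ellS f hf, fun x x' z α h0 h1 hz => (isLeast_opQ hf z).2 ?_⟩
  have hx := hullLevels_upward x _ _ (isLeast_opQ hf x).1 (le_max_left _ (opQ f x'))
  have hx' := hullLevels_upward x' _ _ (isLeast_opQ hf x').1 (le_max_right (opQ f x) _)
  rw [hullLevels, mem_ofPred_eq, hz]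
  exact convex_convexHull ℝ _ hx hx' h0 (sub_nonneg.2 h1) (by ring)

/-- An affine map contracting each coordinate towards `a` sends `x'` to `x`. It maps the lower
contour set into itself because `f` is monotone, hence does the same to the hull. -/
theorem monotone_opQ {f : Icc a b → ℝ} (hf : f ∈ ellS (Icc a b)) (hm : Monotone f) :
    Monotone (opQ f) := by
  intro x x' hxx'
  refine (isLeast_opQ hf x).2 ?_
  have hx' : (x' : Fin k → ℝ) ∈ convexHull ℝ (lowerContour f (opQ f x')) := (isLeast_opQ hf x').1
  set θ : Fin k → ℝ := fun j =>
    ((x : Fin k → ℝ) j - a j) / ((x' : Fin k → ℝ) j - a j) with hθ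
  have hθ0 : ∀ j, 0 ≤ θ j := fun j =>
    div_nonneg (sub_nonneg.2 (x.2.1 j)) (sub_nonneg.2 (x'.2.1 j))
  have hle : ∀ j, (x : Fin k → ℝ) j ≤ (x' : Fin k → ℝ) j := hxx'
  have hθ1 : ∀ j, θ j ≤ 1 := fun j =>
    div_le_one_of_le₀ (sub_le_sub_right (hle j) _) (sub_nonneg.2 (x'.2.1 j))
  -- If `x'_j = a_j` the quotient is `0` by convention, and `x_j = a_j` as well.
  have hθx : ∀ j, θ j * ((x' : Fin k → ℝ) j - a j) = (x : Fin k → ℝ) j - a j := fun j =>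
    div_mul_cancel_of_imp fun h => by linarith [hle j, x.2.1 j]
  let L : (Fin k → ℝ) →ₗ[ℝ] (Fin k → ℝ) := LinearMap.pi fun j => θ j • LinearMap.proj j
  let T : (Fin k → ℝ) →ᵃ[ℝ] (Fin k → ℝ) :=
    L.toAffineMap + AffineMap.const ℝ _ (fun j => a j - θ j * a j)
  have hT : ∀ z j, T z j = θ j * (z j - a j) + a j := by
    intro z j
    have : T z j = θ j * z j + (a j - θ j * a j) := rfl
    rw [this]
    ring
  have hTx : T x' = x := by
    ext j
    rw [hT, hθx]
    ring
  have hmaps : T '' lowerContour f (opQ f x') ⊆ lowerContour f (opQ f x') := by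
    rintro _ ⟨_, ⟨z, hz, rfl⟩, rfl⟩
    have hle' : T z ≤ (z : Fin k → ℝ) := by
      intro j
      rw [hT]
      have := mul_le_of_le_one_left (sub_nonneg.2 (z.2.1 j)) (hθ1 j)
      linarith
    have hge : a ≤ T z := by
      intro j
      rw [hT]
      have := mul_nonneg (hθ0 j) (sub_nonneg.2 (z.2.1 j))
      linarith
    have hmem : T z ∈ Icc a b := ⟨hge, hle'.trans z.2.2⟩
    exact ⟨⟨T z, hmem⟩, (hm (a := ⟨T z, hmem⟩) (b := z) hle').trans hz, rfl⟩
  have := mem_image_of_mem T hx'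
  rw [AffineMap.image_convexHull, hTx] at this
  exact convexHull_mono hmaps this

theorem opQ_eq_self {f : Icc a b → ℝ} (hf : f ∈ ellQ (Icc a b)) : opQ f = f := by
  ext x
  refine (isLeast_opQ hf.1 x).unique ⟨mem_hullLevels_of_le le_rfl, fun y hy => ?_⟩
  have hconv : Convex ℝ (lowerContour f y) := by
    rintro _ ⟨z, hz, rfl⟩ _ ⟨z', hz', rfl⟩ α β hα hβ hαβ
    have hβ' : β = 1 - α := by linarith
    subst hβ'
    have hmem := convex_Icc a b z.2 z'.2 hα hβ hαβ
    exact ⟨⟨_, hmem⟩, (hf.2 z z' ⟨_, hmem⟩ α hα (by linarith) rfl).trans (max_le hz hz'), rfl⟩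
  rw [hullLevels, mem_ofPred_eq, hconv.convexHull_eq] at hy
  obtain ⟨z, hz, he⟩ := hy
  rwa [← Subtype.ext he]

end QuasiConvex

/-! Composition with the range and monotonicity operators -/

section Composition

variable {k : ℕ} {a b : Fin k → ℝ} {lo hi : ℝ} {P : Finset (Equiv.Perm (Fin k))}

theorem opMR_mem_ellS (hlohi : lo ≤ hi) (hP : P.Nonempty) {f : Icc a b → ℝ}
    (hf : f ∈ ellS (Icc a b)) : opMR P lo hi f ∈ ellS (Icc a b) :=
  (isShaping_opM hP).mem_ellS _ (opR_mem_ellS hlohi hf)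

theorem monotone_opMR (hlohi : lo ≤ hi) {f : Icc a b → ℝ} (hf : f ∈ ellS (Icc a b)) :
    Monotone (opMR P lo hi f) :=
  monotone_opM (opR_mem_ellS hlohi hf)

theorem opMR_bounds (hlohi : lo ≤ hi) (hP : P.Nonempty) {f : Icc a b → ℝ}
    (hf : f ∈ ellS (Icc a b)) (x : Icc a b) : lo ≤ opMR P lo hi f x ∧ opMR P lo hi f x ≤ hi :=
  (isShaping_opM hP).range _ (opR_mem_ellS hlohi hf) lo hi (opR_bounds hlohi f) x

theorem opMR_eq_self (hP : P.Nonempty) {f : Icc a b → ℝ} (hf : f ∈ ellS (Icc a b))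
    (hm : Monotone f) (hb : ∀ x, lo ≤ f x ∧ f x ≤ hi) : opMR P lo hi f = f := by
  rw [opMR, opR_eq_self hb, opM_eq_self hP hf hm]

theorem IsShaping.isShiftMonotone_comp_opMR {O : (Icc a b → ℝ) → (Icc a b → ℝ)}
    (hO : IsShaping O) (hlohi : lo ≤ hi) (hP : P.Nonempty) :
    IsShiftMonotone fun f => O (opMR P lo hi f) := fun _ hf _ hg c hc h =>
  hO.shift _ (opMR_mem_ellS hlohi hP hf) _ (opMR_mem_ellS hlohi hP hg) c hc
    ((isShaping_opM hP).shift _ (opR_mem_ellS hlohi hf) _ (opR_mem_ellS hlohi hg) c hc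
      (opR_shift hc h))

/-- Composing an `F`-valued shaping operator that fixes `F` and preserves monotonicity with `MR`. -/
theorem IsShaping.isEnforcing_comp_opMR {O : (Icc a b → ℝ) → (Icc a b → ℝ)}
    {F : Set (Icc a b → ℝ)} (hO : IsShaping O) (hF : F ⊆ ellS (Icc a b))
    (hOF : ∀ f ∈ ellS (Icc a b), O f ∈ F)
    (hOm : ∀ f ∈ ellS (Icc a b), Monotone f → Monotone (O f)) (hOid : ∀ f ∈ F, O f = f)
    (hlohi : lo ≤ hi) (hP : P.Nonempty) :
    IsEnforcing ((F ∩ ellM (Icc a b)) ∩ ellR (Icc a b) lo hi) (ellS (Icc a b))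
      fun f => O (opMR P lo hi f) where
  subset f hf := hF hf.1.1
  reshaping f hf := by
    have h := opMR_mem_ellS hlohi hP hf
    have hO' := (hO.mem_ellS _ h).1
    exact ⟨⟨hOF _ h, hO', hOm _ h (monotone_opMR hlohi hf)⟩, hO',
      hO.range _ h lo hi (opMR_bounds hlohi hP hf)⟩
  invariance f hf := by
    rw [opMR_eq_self hP (hF hf.1.1) hf.1.2.2 hf.2.2, hOid f hf.1.1]
  order_preserving := (hO.isShiftMonotone_comp_opMR hlohi hP).order_preserving

end Composition

end ShapeEnforcing

theorem mainTheorem7 (k : ℕ) (hk : 0 < k) (a b : Fin k → ℝ) (hab : ∀ j, a j < b j)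
    (lo hi : ℝ) (hlohi : lo ≤ hi)
    (P : Finset (Equiv.Perm (Fin k))) (hP : P.Nonempty) :
    -- the operators are well defined: `C` and `Q` are applied to lower semicontinuous functions,
    -- and the minimum that defines `Q` is attained
    (∀ f ∈ ShapeEnforcing.ellS (Set.Icc a b),
      ShapeEnforcing.opMR P lo hi f ∈ ShapeEnforcing.ellS (Set.Icc a b) ∧
      ∀ x, IsLeast (ShapeEnforcing.hullLevels (ShapeEnforcing.opMR P lo hi f) x)
        (ShapeEnforcing.opQMR P lo hi f x)) ∧
    -- (i)
    (ShapeEnforcing.IsEnforcing (ShapeEnforcing.ellCMR (Set.Icc a b) lo hi)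
        (ShapeEnforcing.ellS (Set.Icc a b)) (ShapeEnforcing.opCMR P lo hi) ∧
      ShapeEnforcing.IsDistContraction ShapeEnforcing.dInf
        (ShapeEnforcing.ellS (Set.Icc a b)) (ShapeEnforcing.opCMR P lo hi)) ∧
    -- (ii)
    (ShapeEnforcing.IsEnforcing (ShapeEnforcing.ellQMR (Set.Icc a b) lo hi)
        (ShapeEnforcing.ellS (Set.Icc a b)) (ShapeEnforcing.opQMR P lo hi) ∧
      ShapeEnforcing.IsDistContraction ShapeEnforcing.dInf
        (ShapeEnforcing.ellS (Set.Icc a b)) (ShapeEnforcing.opQMR P lo hi)) := by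
  open ShapeEnforcing in
  exact ⟨fun f hf => ⟨opMR_mem_ellS hlohi hP hf, isLeast_opQ (opMR_mem_ellS hlohi hP hf)⟩,
    ⟨isShaping_opC.isEnforcing_comp_opMR (fun _ hf => hf.1) (fun _ hf => opC_mem_ellC hf)
        (fun _ hf hm => monotone_opC hf.1 hm) (fun _ hf => opC_eq_self hf) hlohi hP,
      (isShaping_opC.isShiftMonotone_comp_opMR hlohi hP).isDistContraction⟩,
    ⟨isShaping_opQ.isEnforcing_comp_opMR (fun _ hf => hf.1) (fun _ hf => opQ_mem_ellQ hf)
        (fun _ hf hm => monotone_opQ hf hm) (fun _ hf => opQ_eq_self hf) hlohi hP,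
      (isShaping_opQ.isShiftMonotone_comp_opMR hlohi hP).isDistContraction⟩⟩
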